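/- Theorem 1.1. Consider the following two-player impartial game, whose positions are abelian groups. A move from an abelian group $A$ consists of picking an element $a \in A$ with $a \neq 0$ and replacing $A$ by the quotient $A/\langle a\rangle$, where $\langle a\rangle$ is the cyclic subgroup generated by $a$; the players alternate, and the game ends when the group is trivial. Under the normal play rule the first player who cannot move loses; under the misère play rule the first player who cannot move wins. A position is called a $\mathcal{P}$-position (for the given rule) if the previous player, i.e. the one who is not about to move, has a winning strategy. An abelian group $A$ is called a square if $A \cong B \times B$ for some abelian group $B$. Let $A$ be a finitely generated abelian group. 1. Under the normal play rule, $A$ is a $\mathcal{P}$-position if and only if $A$ is a square. 2. Under the misère play rule, $A$ is a $\mathcal{P}$-position if and only if one of the following holds: (a) $A$ is a square, and there are no prime number $p$ and even integer $s \geq 0$ with $A \cong (\mathbb{Z}/p)^s$; or (b) $A \cong (\mathbb{Z}/p)^s$ for some prime number $p$ and some odd integer $s \geq 1$. -/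

import Mathlib

/-- The play rules: under the normal rule the first player who cannot move loses, under the
misère rule that player wins. -/
inductive PlayRule : Type where
  | normal
  | misere

/-- An impartial combinatorial game: at every position both players have the same moves.
A position without moves is terminal. (No ending condition is built in.) -/
structure ImpartialGame.{v, w} where
  Position : Type v
  Move : Position → Type w
  next : (p : Position) → Move p → Position

namespace ImpartialGame

universe v w

/-- The position `p` is terminal. -/
def IsTerminal (G : ImpartialGame.{v, w}) (p : G.Position) : Prop :=
  IsEmpty (G.Move p)

mutual

/-- `G.IsNPosition r p`: the next player to move from `p` has a winning strategy under the
play rule `r`. A derivation is such a strategy: either the game is over and the rule lets the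
player who cannot move win, or a move is given together with a winning strategy as the previous
player from the resulting position. -/
inductive IsNPosition (G : ImpartialGame.{v, w}) (r : PlayRule) : G.Position → Prop where
  | over {p : G.Position} (hr : r = PlayRule.misere) (hp : G.IsTerminal p) :
      IsNPosition G r p
  | move {p : G.Position} (m : G.Move p) (h : IsPPosition G r (G.next p m)) :
      IsNPosition G r p

/-- `G.IsPPosition r p`: the previous player, i.e. the one who has just moved to `p`, has a
winning strategy under the play rule `r`. A derivation is such a strategy: either the game is
over and the rule lets the player who cannot move lose, or the game is not over and after every
move of the opponent there is a winning strategy as the next player. Derivations are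
well-founded, so play according to the strategy ends after finitely many moves. -/
inductive IsPPosition (G : ImpartialGame.{v, w}) (r : PlayRule) : G.Position → Prop where
  | over {p : G.Position} (hr : r = PlayRule.normal) (hp : G.IsTerminal p) :
      IsPPosition G r p
  | reply {p : G.Position} (hp : ¬ G.IsTerminal p)
      (h : ∀ m : G.Move p, IsNPosition G r (G.next p m)) :
      IsPPosition G r p

end

end ImpartialGame

universe u

/-- The game of abelian groups: the positions are the abelian groups, and a move from `B` picks
an element `b ≠ 0` of `B` and replaces `B` by the quotient of `B` by the cyclic subgroup
generated by `b`. -/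
def abelianGroupGame : ImpartialGame.{u + 1, u} where
  Position := AddCommGrpCat.{u}
  Move B := {b : B // b ≠ 0}
  next B b := AddCommGrpCat.of (B ⧸ AddSubgroup.zmultiples (b : B))

/-- `A` is a square: it is isomorphic to `B × B` for some abelian group `B`. -/
def IsSquareGroup (A : Type u) [AddCommGroup A] : Prop :=
  ∃ (B : Type u) (_ : AddCommGroup B), Nonempty (A ≃+ B × B)

/-! The `𝒫`-positions are determined by a recursion, which noetherian induction on the quotients of
`A` turns into a criterion (`isPPosition_iff_of_recursion`): a class of groups consists of the
`𝒫`-positions if it is right on the trivial group and, for nontrivial `A`, contains `A` exactly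
when it contains no quotient `A / ⟨a⟩` with `a ≠ 0`.

For normal play the class is that of the squares.

* From a nonsquare one can move to a square. In the invariant factor form `d₁ ∣ d₂ ∣ ⋯` pair up the
  factors, after putting `1` in front if their number is odd; one cyclic subgroup reduces every
  pair `ℤ/d₁ × ℤ/d₂` to `ℤ/d₁ × ℤ/d₁` at once (`CyclicSum.exists_surjective_square`).
* From a square one cannot (`IsSquareGroup.not_quotient`). By residual finiteness there are a prime
  `p` and `M > 0` with `a ∈ M A` and `a ∉ p M A`. Then `a` has order `p` in the finite group
  `A / p M A`, so the indices of `p M A` in `A` and of its image in `A / ⟨a⟩` have ratio `p`,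
  whereas for squares both indices are perfect squares.

For misère play the class changes only on elementary abelian groups, where every move lowers the
dimension by one. If a square `A` has an elementary abelian quotient `A / ⟨a⟩`, then `p A ⊆ ⟨a⟩` is
a cyclic square, hence `0`, so `A` is elementary abelian as well. If a nonsquare `A` that is not
elementary abelian has a move to an even-dimensional elementary abelian group, then it also has one
to an odd-dimensional one (`exists_isOddElementary_quotient`): the quotient by `p A` or by a cyclic
group that properly contains `p A`. -/

/-! ### Invariant factors -/

/-- The direct sum of the cyclic groups `ℤ/d`, for `d` in the list `L`, as an iterated binary
product; `d = 0` stands for an infinite cyclic summand. -/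
def CyclicSum : List ℕ → Type
  | [] => Unit
  | d :: L => ZMod d × CyclicSum L

instance instAddCommGroupCyclicSum : ∀ L : List ℕ, AddCommGroup (CyclicSum L)
  | [] => inferInstanceAs (AddCommGroup Unit)
  | d :: L =>
    letI := instAddCommGroupCyclicSum L
    inferInstanceAs (AddCommGroup (ZMod d × CyclicSum L))

/-- The homomorphism `ℤ/n → A` that sends `1` to the `n`-torsion element `a`. -/
def ZMod.homOfTorsion {A : Type*} [AddCommGroup A] (n : ℕ) (a : A) (h : n • a = 0) :
    ZMod n →+ A :=
  ZMod.lift n ⟨zmultiplesHom A a, by simpa using h⟩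

@[simp]
lemma ZMod.homOfTorsion_intCast {A : Type*} [AddCommGroup A] (n : ℕ) (a : A) (h : n • a = 0)
    (k : ℤ) : ZMod.homOfTorsion n a h (k : ZMod n) = k • a := by
  simp [ZMod.homOfTorsion]

lemma ZMod.prod_hom_ext {A : Type*} [AddCommGroup A] {m n : ℕ} {f g : ZMod m × ZMod n →+ A}
    (h : ∀ x y : ℤ, f (x, y) = g (x, y)) : f = g := by
  ext ⟨x, y⟩
  obtain ⟨x, rfl⟩ := ZMod.intCast_surjective x
  obtain ⟨y, rfl⟩ := ZMod.intCast_surjective y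
  exact h x y

lemma ZMod.zsmul_mk_add_zsmul_mk {m n : ℕ} (s t a b c e : ℤ) :
    s • ((a : ZMod m), (b : ZMod n)) + t • ((c : ZMod m), (e : ZMod n)) =
      (((s * a + t * c : ℤ) : ZMod m), ((s * b + t * e : ℤ) : ZMod n)) := by
  ext <;> simp

/-- `ℤ/d × ℤ/n ≅ ℤ/gcd(d,n) × ℤ/lcm(d,n)`, also when `d` or `n` is `0`. -/
lemma ZMod.nonempty_prod_addEquiv_gcd_lcm (d n : ℕ) :
    Nonempty (ZMod d × ZMod n ≃+ ZMod (d.gcd n) × ZMod (d.lcm n)) := by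
  -- Write `d = g d'`, `n = g n'` with `u d' + v n' = 1`; the matrices `(u, -v; n', d')` and
  -- `(d', v; -n', u)` are inverse to each other over `ℤ` and respect the relations.
  obtain ⟨d', n', u, v, hd, hn, hl, huv⟩ : ∃ d' n' : ℕ, ∃ u v : ℤ, d = d.gcd n * d' ∧
      n = d.gcd n * n' ∧ d.lcm n = d.gcd n * d' * n' ∧ u * d' + v * n' = 1 := by
    rcases Nat.eq_zero_or_pos (d.gcd n) with h0 | hpos
    · obtain ⟨rfl, rfl⟩ := Nat.gcd_eq_zero_iff.mp h0
      exact ⟨1, 0, 1, 0, by simp⟩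
    · obtain ⟨d', n', hco, hd, hn⟩ := Nat.exists_coprime d n
      refine ⟨d', n', d'.gcdA n', d'.gcdB n', by rw [mul_comm]; exact hd,
        by rw [mul_comm]; exact hn, ?_, ?_⟩
      · rw [Nat.lcm, Nat.div_eq_iff_eq_mul_left hpos ((Nat.gcd_dvd_left d n).mul_right n)]
        linear_combination n * hd + d' * d.gcd n * hn
      · have := Nat.gcd_eq_gcd_ab d' n'
        rw [hco.gcd_eq_one] at this
        push_cast at this
        linarith
  generalize d.gcd n = g at *
  generalize d.lcm n = l at *
  subst hd hn hl
  have hcast : ∀ (k : ℕ) (z : ℤ), (k : ℤ) ∣ z → (z : ZMod k) = 0 := fun k z h =>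
    (ZMod.intCast_zmod_eq_zero_iff_dvd _ _).mpr h
  have h1 : (g * d') • (((u : ℤ) : ZMod g), ((n' : ℤ) : ZMod (g * d' * n'))) = 0 := by
    ext
    · simp
    · simpa using hcast (g * d' * n') (g * d' * n') (by simp)
  have h2 : (g * n') • (((-v : ℤ) : ZMod g), ((d' : ℤ) : ZMod (g * d' * n'))) = 0 := by
    ext
    · simp
    · simpa using hcast (g * d' * n') (g * n' * d') ⟨1, by push_cast; ring⟩
  have h3 : g • (((d' : ℤ) : ZMod (g * d')), ((-n' : ℤ) : ZMod (g * n'))) = 0 := by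
    ext
    · simpa using hcast (g * d') (g * d') (by simp)
    · simpa using hcast (g * n') (g * n') (by simp)
  have h4 : (g * d' * n') • (((v : ℤ) : ZMod (g * d')), ((u : ℤ) : ZMod (g * n'))) = 0 := by
    ext
    · simp
    · simpa using hcast (g * n') (g * d' * n' * u) ⟨d' * u, by push_cast; ring⟩
  refine ⟨AddMonoidHom.toAddEquiv
    ((ZMod.homOfTorsion _ _ h1).coprod (ZMod.homOfTorsion _ _ h2))
    ((ZMod.homOfTorsion _ _ h3).coprod (ZMod.homOfTorsion _ _ h4)) ?_ ?_⟩
  all_goals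
    refine ZMod.prod_hom_ext fun x y => ?_
    simp only [AddMonoidHom.comp_apply, AddMonoidHom.coprod_apply, ZMod.homOfTorsion_intCast,
      AddMonoidHom.id_apply, ZMod.zsmul_mk_add_zsmul_mk]
    congr 2
    · linear_combination x * huv
    · linear_combination y * huv

/-- Adding a cyclic summand to a group in invariant factor form: the new order `n` is moved
through the list by replacing `d, n` with `gcd(d, n), lcm(d, n)`. The first clause of the
conclusion keeps track of divisibility from below, as the recursion needs it. -/
lemma CyclicSum.exists_insert (L : List ℕ) (hL : L.Pairwise (· ∣ ·)) (n : ℕ) :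
    ∃ L' : List ℕ, (∀ c, c ∣ n → (∀ d ∈ L, c ∣ d) → ∀ d ∈ L', c ∣ d) ∧ L'.Pairwise (· ∣ ·) ∧
      Nonempty (ZMod n × CyclicSum L ≃+ CyclicSum L') := by
  induction L generalizing n with
  | nil =>
    exact ⟨[n], by simp, by simp, ⟨AddEquiv.refl _⟩⟩
  | cons d L ih =>
    obtain ⟨hd, hL⟩ := List.pairwise_cons.mp hL
    obtain ⟨L', hdvd, hL', ⟨e⟩⟩ := ih hL (d.lcm n)
    obtain ⟨f⟩ := ZMod.nonempty_prod_addEquiv_gcd_lcm d n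
    refine ⟨d.gcd n :: L', fun c hcn hc => ?_, List.pairwise_cons.mpr ⟨?_, hL'⟩, ⟨?_⟩⟩
    · simp only [List.mem_cons, forall_eq_or_imp] at hc ⊢
      exact ⟨Nat.dvd_gcd hc.1 hcn, hdvd c (hcn.trans (Nat.dvd_lcm_right d n)) hc.2⟩
    · exact hdvd _ ((Nat.gcd_dvd_right d n).trans (Nat.dvd_lcm_right d n)) fun k hk =>
        (Nat.gcd_dvd_left d n).trans (hd k hk)
    · exact AddEquiv.prodAssoc.symm.trans ((AddEquiv.prodComm.trans f |>.prodCongr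
        (AddEquiv.refl (CyclicSum L))).trans (AddEquiv.prodAssoc.trans
        ((AddEquiv.refl (ZMod (d.gcd n))).prodCongr e)))

lemma CyclicSum.exists_addEquiv_pi_prod {ι : Type} [Finite ι] (d : ι → ℕ) {A : Type*}
    [AddCommGroup A] (hA : ∃ L : List ℕ, L.Pairwise (· ∣ ·) ∧ Nonempty (A ≃+ CyclicSum L)) :
    ∃ L : List ℕ, L.Pairwise (· ∣ ·) ∧ Nonempty (((i : ι) → ZMod (d i)) × A ≃+ CyclicSum L) := by
  induction ι using Finite.induction_empty_option with
  | @of_equiv α β e ih =>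
    obtain ⟨L, hL, ⟨f⟩⟩ := ih fun i => d (e i)
    exact ⟨L, hL, ⟨((LinearEquiv.piCongrLeft ℤ (fun i => ZMod (d i)) e).toAddEquiv.symm.prodCongr
      (AddEquiv.refl A)).trans f⟩⟩
  | h_empty =>
    obtain ⟨L, hL, ⟨f⟩⟩ := hA
    exact ⟨L, hL, ⟨AddEquiv.uniqueProd.trans f⟩⟩
  | @h_option α _ ih =>
    obtain ⟨L, hL, ⟨f⟩⟩ := ih fun i => d (some i)
    obtain ⟨L', -, hL', ⟨g⟩⟩ := CyclicSum.exists_insert L hL (d none)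
    exact ⟨L', hL', ⟨((LinearEquiv.piOptionEquivProd ℤ).toAddEquiv.prodCongr
      (AddEquiv.refl A)).trans (AddEquiv.prodAssoc.trans
      (((AddEquiv.refl _).prodCongr f).trans g))⟩⟩

/-- Invariant factor decomposition of a finitely generated abelian group. -/
lemma exists_addEquiv_cyclicSum (A : Type*) [AddCommGroup A] [AddGroup.FG A] :
    ∃ L : List ℕ, L.Pairwise (· ∣ ·) ∧ Nonempty (A ≃+ CyclicSum L) := by
  obtain ⟨n, ι, _, p, -, e, ⟨f⟩⟩ := AddCommGroup.equiv_free_prod_directSum_zmod A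
  obtain ⟨L, hL, ⟨g⟩⟩ := CyclicSum.exists_addEquiv_pi_prod (fun i => p i ^ e i)
    ⟨[], List.Pairwise.nil, ⟨AddEquiv.refl Unit⟩⟩
  obtain ⟨L', hL', ⟨h⟩⟩ := CyclicSum.exists_addEquiv_pi_prod (fun _ : Fin n => 0) ⟨L, hL, ⟨g⟩⟩
  have k : (Fin n →₀ ℤ) ≃+ (Fin n → ZMod 0) :=
    (Finsupp.linearEquivFunOnFinite ℤ ℤ (Fin n)).toAddEquiv
  exact ⟨L', hL', ⟨f.trans ((k.prodCongr ((DirectSum.addEquivProd _).trans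
    AddEquiv.prodUnique.symm)).trans h)⟩⟩

/-- Finitely generated abelian groups are residually finite, in the form that a nonzero element
is not divisible by every positive integer. -/
lemma exists_pos_forall_nsmul_ne {A : Type*} [AddCommGroup A] [AddGroup.FG A] {a : A}
    (ha : a ≠ 0) : ∃ N : ℕ, 0 < N ∧ ∀ b : A, N • b ≠ a := by
  have key : ∀ (L : List ℕ) (x : CyclicSum L), x ≠ 0 → ∃ N : ℕ, 0 < N ∧ ∀ y, N • y ≠ x := by
    intro L
    induction L with
    | nil => exact fun x hx => (hx rfl).elim
    | cons d L ih =>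
      rintro ⟨x, y⟩ hxy
      by_cases hy : y = 0
      · have hx : x ≠ 0 := by
          rintro rfl
          exact hxy (by rw [hy]; rfl)
        rcases Nat.eq_zero_or_pos d with rfl | hd
        · -- an integer `x ≠ 0` is not divisible by `|x| + 1`
          change ℤ at x
          refine ⟨x.natAbs + 1, by omega, ?_⟩
          rintro ⟨z, w⟩ h
          have h1 : (x.natAbs + 1) • (z : ℤ) = x := congrArg Prod.fst h
          have h2 := Int.natAbs_dvd_natAbs.mpr (Dvd.intro _ ((nsmul_eq_mul _ _).symm.trans h1))
          have h3 := Nat.le_of_dvd (Int.natAbs_pos.mpr hx) h2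
          rw [Int.natAbs_natCast] at h3
          omega
        · refine ⟨d, hd, ?_⟩
          rintro ⟨z, w⟩ h
          have h1 : d • z = x := congrArg Prod.fst h
          exact hx (by rw [← h1]; simp)
      · obtain ⟨N, hN, h⟩ := ih y hy
        refine ⟨N, hN, ?_⟩
        rintro ⟨z, w⟩ h'
        exact h w (congrArg Prod.snd h')
  obtain ⟨L, -, ⟨e⟩⟩ := exists_addEquiv_cyclicSum A
  obtain ⟨N, hN, h⟩ := key L (e a) (by simpa using ha)
  exact ⟨N, hN, fun b hb => h (e b) (by rw [← map_nsmul, hb])⟩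

/-! ### A cyclic subgroup with square quotient -/

/-- Let `d ∣ d₁ ∣ d₂`. If `H` has a square quotient by the cyclic subgroup of `d₂ • q`, then
`ℤ/d₁ × ℤ/d₂ × H` has one by the cyclic subgroup of `d₁ • (0, 1, q)`: the new coordinate
`y = (1, q)` satisfies `d₂ y = d₂ q`, so that killing `d₁ y` leaves `ℤ/d₁ × ℤ/d₁ × H/⟨d₂ q⟩`. -/
lemma exists_surjective_square_prod {H B : Type} [AddCommGroup H] [AddCommGroup B] {d d₁ d₂ : ℕ}
    (hd : d ∣ d₁) (h12 : d₁ ∣ d₂) (f : H →+ B × B) (q : H) (hf : Function.Surjective f)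
    (hker : f.ker = AddSubgroup.zmultiples (d₂ • q)) :
    ∃ (C : Type) (_ : AddCommGroup C) (g : ZMod d₁ × (ZMod d₂ × H) →+ C × C)
      (w : ZMod d₁ × (ZMod d₂ × H)),
      Function.Surjective g ∧ g.ker = AddSubgroup.zmultiples (d • w) := by
  have hq : d₂ • f q = 0 := by
    rw [← map_nsmul, ← AddMonoidHom.mem_ker, hker]
    exact AddSubgroup.mem_zmultiples _
  obtain ⟨k, rfl⟩ := hd
  let φ : ZMod (d * k) × (ZMod d₂ × H) →+ ZMod (d * k) × (ZMod (d * k) × (B × B)) :=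
    (AddMonoidHom.id _).prodMap
      (((ZMod.castHom h12 (ZMod (d * k))).toAddMonoidHom.comp (AddMonoidHom.fst _ _)).prod
        (f.comp (AddMonoidHom.snd _ _) -
          (ZMod.homOfTorsion d₂ (f q) hq).comp (AddMonoidHom.fst _ _)))
  have hφ : ∀ (w : ZMod (d * k)) (x : ℤ) (h : H),
      φ (w, (x, h)) = (w, ((x : ZMod (d * k)), f h - x • f q)) := by
    intro w x h
    simp [φ]
  let e : ZMod (d * k) × (ZMod (d * k) × (B × B)) ≃+ (ZMod (d * k) × B) × (ZMod (d * k) × B) :=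
    AddEquiv.prodAssoc.symm.trans (AddEquiv.prodProdProdComm _ _ _ _)
  refine ⟨ZMod (d * k) × B, inferInstance, e.toAddMonoidHom.comp φ, (0, (k, k • q)), ?_, ?_⟩
  · refine e.surjective.comp ?_
    rintro ⟨w, x, b⟩
    obtain ⟨x, rfl⟩ := ZMod.intCast_surjective x
    obtain ⟨h, hh⟩ := hf (b + x • f q)
    exact ⟨(w, (x, h)), by rw [hφ, hh, add_sub_cancel_right]⟩
  · have hgen : ∀ j : ℤ, j • d • ((0, (k, k • q)) : ZMod (d * k) × (ZMod d₂ × H)) =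
        (0, (((j * (d * k) : ℤ) : ZMod d₂), (j * (d * k)) • q)) := by
      intro j
      ext
      · simp
      · simp
      · simp [mul_smul]
    ext ⟨w, x, h⟩
    obtain ⟨x, rfl⟩ := ZMod.intCast_surjective x
    rw [AddMonoidHom.mem_ker, AddSubgroup.mem_zmultiples_iff]
    change e (φ (w, (x, h))) = 0 ↔ _
    rw [map_eq_zero_iff e e.injective, hφ]
    simp only [hgen]
    constructor
    · intro H
      simp only [Prod.mk_eq_zero] at H
      obtain ⟨rfl, hx, hh⟩ := H
      rw [← map_zsmul, ← map_sub, ← AddMonoidHom.mem_ker, hker,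
        AddSubgroup.mem_zmultiples_iff] at hh
      obtain ⟨i, hi⟩ := hh
      obtain ⟨m, hm⟩ := (ZMod.intCast_zmod_eq_zero_iff_dvd _ _).mp hx
      obtain ⟨c, rfl⟩ := h12
      -- in `ℤ/d₂` the class of `x` does not change when a multiple of `d₂` is added
      refine ⟨m + i * c, ?_⟩
      have hxx : (m + i * c) * ((d : ℤ) * k) = x + i * (d * k * c : ℕ) := by
        rw [hm]; push_cast; ring
      rw [hxx]
      ext
      · rfl
      · simp only [Int.cast_add, Int.cast_mul, Int.cast_natCast, ZMod.natCast_self, mul_zero,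
          add_zero]
      · change (x + i * (d * k * c : ℕ)) • q = h
        rw [add_zsmul, mul_zsmul, natCast_zsmul, hi]
        abel
    · rintro ⟨j, hj⟩
      simp only [Prod.mk.injEq] at hj
      obtain ⟨rfl, hx, rfl⟩ := hj
      have hx' := (ZMod.intCast_eq_intCast_iff_dvd_sub _ _ _).mp hx
      have hxd : ((d * k : ℕ) : ℤ) ∣ x := by
        have h2 := (Int.natCast_dvd_natCast.mpr h12).trans hx'
        have h3 : ((d * k : ℕ) : ℤ) ∣ j * (d * k) := ⟨j, by push_cast; ring⟩
        simpa using dvd_add h2 h3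
      obtain ⟨i, hi⟩ := hx'
      have hz : f ((j * ((d : ℤ) * k)) • q) - x • f q = 0 := by
        rw [map_zsmul, ← sub_smul, ← neg_sub, neg_smul, hi, mul_comm, mul_zsmul,
          natCast_zsmul, hq, smul_zero, neg_zero]
      rw [hz, (ZMod.intCast_zmod_eq_zero_iff_dvd _ _).mpr hxd]
      rfl

/-- Pair up the invariant factors `d₁ ∣ d₂ ∣ ⋯` from the smallest. The quotient by a suitable
cyclic subgroup is the square of the sum of the smaller members of the pairs. That the generator
is divisible by any given lower bound `d` of the list is what lets the recursion continue. -/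
lemma CyclicSum.exists_surjective_square : ∀ (L : List ℕ), L.Pairwise (· ∣ ·) → Even L.length →
    ∀ d : ℕ, (∀ k ∈ L, d ∣ k) → ∃ (B : Type) (_ : AddCommGroup B) (f : CyclicSum L →+ B × B)
      (w : CyclicSum L), Function.Surjective f ∧ f.ker = AddSubgroup.zmultiples (d • w)
  | [], _, _, d, _ => by
    refine ⟨Unit, inferInstance, 0, 0, fun _ => ⟨0, rfl⟩, ?_⟩
    ext x
    simp only [AddMonoidHom.ker_zero, AddSubgroup.mem_top, smul_zero, true_iff]
    exact ⟨0, rfl⟩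
  | [_], _, h, _, _ => by simp at h
  | d₁ :: d₂ :: L, hL, hlen, d, hd => by
    obtain ⟨h₁, hL⟩ := List.pairwise_cons.mp hL
    obtain ⟨h₂, hL⟩ := List.pairwise_cons.mp hL
    obtain ⟨B, _, f, q, hf, hker⟩ := CyclicSum.exists_surjective_square L hL
      (by simpa [Nat.even_add_one] using hlen) d₂ h₂
    exact exists_surjective_square_prod (hd d₁ (by simp)) (h₁ d₂ (by simp)) f q hf hker

lemma IsSquareGroup.of_addEquiv {A B : Type u} [AddCommGroup A] [AddCommGroup B] (e : A ≃+ B)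
    (hB : IsSquareGroup B) : IsSquareGroup A := by
  obtain ⟨C, _, ⟨f⟩⟩ := hB
  exact ⟨C, inferInstance, ⟨e.trans f⟩⟩

/-- Every finitely generated abelian group has a cyclic subgroup with square quotient. -/
lemma exists_isSquareGroup_quotient (A : Type u) [AddCommGroup A] [AddGroup.FG A] :
    ∃ a : A, IsSquareGroup (A ⧸ AddSubgroup.zmultiples a) := by
  obtain ⟨L, hL, hlen, ⟨e⟩⟩ : ∃ L : List ℕ, L.Pairwise (· ∣ ·) ∧ Even L.length ∧
      Nonempty (A ≃+ CyclicSum L) := by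
    obtain ⟨L, hL, ⟨e⟩⟩ := exists_addEquiv_cyclicSum A
    rcases Nat.even_or_odd L.length with h | h
    · exact ⟨L, hL, h, ⟨e⟩⟩
    · refine ⟨1 :: L, by simpa using hL, by simpa [Nat.even_add_one] using h, ⟨e.trans ?_⟩⟩
      have u : ZMod 1 × CyclicSum L ≃+ CyclicSum L := AddEquiv.uniqueProd
      exact u.symm
  obtain ⟨B, _, f, w, hf, hker⟩ := CyclicSum.exists_surjective_square L hL hlen 1 (by simp)
  rw [one_smul] at hker
  let g : A →+ B × B := f.comp e.toAddMonoidHom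
  have hg : g.ker = AddSubgroup.zmultiples (e.symm w) := by
    ext x
    have h1 : x ∈ g.ker ↔ e x ∈ f.ker := Iff.rfl
    rw [h1, hker, AddSubgroup.mem_zmultiples_iff, AddSubgroup.mem_zmultiples_iff]
    refine exists_congr fun k => ?_
    rw [← map_zsmul, AddEquiv.symm_apply_eq]
  refine ⟨e.symm w, ULift.{u} B, inferInstance, ⟨?_⟩⟩
  exact (QuotientAddGroup.quotientAddEquivOfEq hg).symm.trans
    ((QuotientAddGroup.quotientKerEquivOfSurjective g (hf.comp e.surjective)).trans
      (AddEquiv.ulift.symm.prodCongr AddEquiv.ulift.symm))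

/-! ### Squares have no square quotient by a nontrivial cyclic subgroup -/

/-- The subgroup `N A` of the multiples of `N` in `A`. -/
def multiplesSubgroup (N : ℕ) (A : Type*) [AddCommGroup A] : AddSubgroup A :=
  (nsmulAddMonoidHom N : A →+ A).range

lemma mem_multiplesSubgroup {N : ℕ} {A : Type*} [AddCommGroup A] {x : A} :
    x ∈ multiplesSubgroup N A ↔ ∃ y, N • y = x := Iff.rfl

lemma index_multiplesSubgroup_of_addEquiv {A B : Type*} [AddCommGroup A] [AddCommGroup B]
    (e : A ≃+ B) (N : ℕ) : (multiplesSubgroup N A).index = (multiplesSubgroup N B).index := by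
  rw [← AddSubgroup.index_map_equiv (multiplesSubgroup N A) e]
  congr 1
  ext x
  simp only [AddSubgroup.mem_map, mem_multiplesSubgroup]
  constructor
  · rintro ⟨_, ⟨y, rfl⟩, rfl⟩
    exact ⟨e y, by simp⟩
  · rintro ⟨y, rfl⟩
    exact ⟨N • e.symm y, ⟨e.symm y, rfl⟩, by simp⟩

lemma index_multiplesSubgroup_prod (B : Type*) [AddCommGroup B] (N : ℕ) :
    (multiplesSubgroup N (B × B)).index = (multiplesSubgroup N B).index ^ 2 := by
  rw [sq, ← AddSubgroup.index_prod]
  congr 1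
  exact AddMonoidHom.range_prodMap (nsmulAddMonoidHom N : B →+ B) (nsmulAddMonoidHom N : B →+ B)

lemma isSquare_index_multiplesSubgroup {A : Type u} [AddCommGroup A] (hA : IsSquareGroup A)
    (N : ℕ) : IsSquare (multiplesSubgroup N A).index := by
  obtain ⟨B, _, ⟨e⟩⟩ := hA
  rw [index_multiplesSubgroup_of_addEquiv e, index_multiplesSubgroup_prod]
  exact IsSquare.sq _

lemma index_sup_zmultiples {A : Type*} [AddCommGroup A] (H : AddSubgroup A) (a : A) :
    (H ⊔ AddSubgroup.zmultiples a).index =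
      (AddSubgroup.zmultiples (QuotientAddGroup.mk' H a)).index := by
  rw [← AddSubgroup.index_comap_of_surjective _ (QuotientAddGroup.mk'_surjective H),
    ← AddMonoidHom.map_zmultiples, AddSubgroup.comap_map_eq, QuotientAddGroup.ker_mk', sup_comm]

lemma index_multiplesSubgroup_quotient {A : Type*} [AddCommGroup A] (a : A) (N : ℕ) :
    (multiplesSubgroup N (A ⧸ AddSubgroup.zmultiples a)).index =
      (multiplesSubgroup N A ⊔ AddSubgroup.zmultiples a).index := by
  let π := QuotientAddGroup.mk' (AddSubgroup.zmultiples a)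
  have h : multiplesSubgroup N (A ⧸ AddSubgroup.zmultiples a) =
      (multiplesSubgroup N A).map π := by
    ext x
    simp only [AddSubgroup.mem_map, mem_multiplesSubgroup]
    constructor
    · rintro ⟨y, rfl⟩
      obtain ⟨y, rfl⟩ := QuotientAddGroup.mk'_surjective _ y
      exact ⟨N • y, ⟨y, rfl⟩, map_nsmul π N y⟩
    · rintro ⟨_, ⟨y, rfl⟩, rfl⟩
      exact ⟨π y, (map_nsmul π N y).symm⟩
  rw [h, ← AddSubgroup.index_comap_of_surjective _ (QuotientAddGroup.mk'_surjective _),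
    AddSubgroup.comap_map_eq, QuotientAddGroup.ker_mk']

lemma index_sup_zmultiples_mul_prime {A : Type*} [AddCommGroup A] {H : AddSubgroup A} {a : A}
    {p : ℕ} (hp : p.Prime) (ha : a ∉ H) (hpa : p • a ∈ H) :
    (H ⊔ AddSubgroup.zmultiples a).index * p = H.index := by
  have := Fact.mk hp
  have h : addOrderOf (QuotientAddGroup.mk' H a) = p := by
    refine addOrderOf_eq_prime ?_ ?_
    · rw [← map_nsmul]
      exact (QuotientAddGroup.eq_zero_iff _).mpr hpa
    · exact fun h => ha ((QuotientAddGroup.eq_zero_iff _).mp h)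
  rw [index_sup_zmultiples]
  conv_lhs => rw [← h, ← Nat.card_zmultiples]
  exact AddSubgroup.index_mul_card _

lemma index_multiplesSubgroup_ne_zero (A : Type*) [AddCommGroup A] [AddGroup.FG A] {N : ℕ}
    (hN : 0 < N) : (multiplesSubgroup N A).index ≠ 0 := by
  have : Finite (A ⧸ multiplesSubgroup N A) := by
    refine AddCommGroup.finite_of_fg_isAddTorsion _ fun x => ?_
    obtain ⟨x, rfl⟩ := QuotientAddGroup.mk'_surjective _ x
    refine isOfFinAddOrder_iff_nsmul_eq_zero.mpr ⟨N, hN, ?_⟩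
    rw [← map_nsmul]
    exact (QuotientAddGroup.eq_zero_iff _).mpr ⟨x, rfl⟩
  exact AddSubgroup.index_ne_zero_of_finite

/-- In a finitely generated abelian group every `a ≠ 0` is seen by a prime: there are `p` and `M`
with `a ∈ M A` and `a ∉ p M A`. -/
lemma exists_prime_mem_multiplesSubgroup {A : Type*} [AddCommGroup A] [AddGroup.FG A] {a : A}
    (ha : a ≠ 0) : ∃ p M : ℕ, p.Prime ∧ 0 < M ∧ a ∈ multiplesSubgroup M A ∧
      a ∉ multiplesSubgroup (p * M) A := by
  classical
  have hex : ∃ N : ℕ, 0 < N ∧ a ∉ multiplesSubgroup N A := by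
    obtain ⟨N, hN, h⟩ := exists_pos_forall_nsmul_ne ha
    exact ⟨N, hN, fun ⟨b, hb⟩ => h b hb⟩
  obtain ⟨hpos, hnot⟩ := Nat.find_spec hex
  have hne : Nat.find hex ≠ 1 := by
    intro h
    rw [h] at hnot
    exact hnot ⟨a, one_smul ℕ a⟩
  obtain ⟨M, hM⟩ := Nat.minFac_dvd (Nat.find hex)
  have hp := Nat.minFac_prime hne
  have hMpos : 0 < M := Nat.pos_of_ne_zero fun h => by rw [h, mul_zero] at hM; omega
  refine ⟨(Nat.find hex).minFac, M, hp, hMpos, ?_, by rwa [← hM]⟩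
  have hlt : M < Nat.find hex := by
    conv_rhs => rw [hM]
    exact lt_mul_of_one_lt_left hMpos hp.one_lt
  by_contra h
  exact Nat.find_min hex hlt ⟨hMpos, h⟩

/-- With `a ∈ M A` and `a ∉ p M A`, the orders of `A / p M A` and of the same quotient of
`A / ⟨a⟩` differ by the factor `p`, so they are not both squares. -/
lemma IsSquareGroup.not_quotient {A : Type u} [AddCommGroup A] [AddGroup.FG A]
    (hA : IsSquareGroup A) {a : A} (ha : a ≠ 0) :
    ¬ IsSquareGroup (A ⧸ AddSubgroup.zmultiples a) := by
  intro hC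
  obtain ⟨p, M, hp, hM, ⟨b, hb⟩, hnot⟩ := exists_prime_mem_multiplesSubgroup ha
  have hpa : p • a ∈ multiplesSubgroup (p * M) A := ⟨b, by
    rw [← hb]; exact mul_smul p M b⟩
  have h1 := index_sup_zmultiples_mul_prime hp hnot hpa
  have h0 := index_multiplesSubgroup_ne_zero A (Nat.mul_pos hp.pos hM)
  obtain ⟨m, hm⟩ := isSquare_index_multiplesSubgroup hA (p * M)
  obtain ⟨k, hk⟩ := isSquare_index_multiplesSubgroup hC (p * M)
  rw [← index_multiplesSubgroup_quotient, hk, hm] at h1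
  rw [hm] at h0
  have hk0 : k ≠ 0 := by
    rintro rfl
    exact h0 (by simpa using h1.symm)
  have := Fact.mk hp
  -- compare the exponents of `p` in `k² p = m²`
  have h2 := congrArg (padicValNat p) h1
  have hm0 : m ≠ 0 := left_ne_zero_of_mul h0
  rw [padicValNat.mul (mul_ne_zero hk0 hk0) hp.ne_zero, padicValNat.mul hk0 hk0,
    padicValNat.mul hm0 hm0, padicValNat_self] at h2
  omega

/-! ### Elementary abelian groups -/

lemma nonempty_addEquiv_pi_zmod_iff {A : Type*} [AddCommGroup A] {p : ℕ} (hp : p.Prime) (s : ℕ) :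
    Nonempty (A ≃+ (Fin s → ZMod p)) ↔ (∀ x : A, p • x = 0) ∧ Nat.card A = p ^ s := by
  have := Fact.mk hp
  constructor
  · rintro ⟨e⟩
    refine ⟨fun x => e.injective ?_, ?_⟩
    · rw [map_nsmul, map_zero]
      ext i
      simp
    · rw [Nat.card_congr e.toEquiv]
      simp
  · rintro ⟨h, hcard⟩
    let : Module (ZMod p) A := AddCommGroup.zmodModule (n := p) (G := A) h
    have : Finite A := Nat.finite_of_card_ne_zero (by rw [hcard]; exact pow_ne_zero _ hp.ne_zero)
    have : Module.Finite (ZMod p) A := inferInstance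
    have hs : Module.finrank (ZMod p) A = s := by
      have h1 := Module.natCard_eq_pow_finrank (K := ZMod p) (V := A)
      rw [hcard, Nat.card_zmod] at h1
      exact (Nat.pow_right_injective hp.two_le h1).symm
    subst hs
    have b := Module.finBasis (ZMod p) A
    exact ⟨b.equivFun.toAddEquiv⟩

lemma exists_addEquiv_pi_zmod {A : Type*} [AddCommGroup A] [AddGroup.FG A] {p : ℕ}
    (hp : p.Prime) (h : ∀ x : A, p • x = 0) : ∃ s, Nonempty (A ≃+ (Fin s → ZMod p)) := by
  have := Fact.mk hp
  let : Module (ZMod p) A := AddCommGroup.zmodModule (n := p) (G := A) h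
  have : Module.Finite ℤ A := Module.Finite.iff_addGroup_fg.mpr inferInstance
  have : Module.Finite (ZMod p) A := Module.Finite.of_restrictScalars_finite ℤ (ZMod p) A
  have b := Module.finBasis (ZMod p) A
  exact ⟨_, ⟨b.equivFun.toAddEquiv⟩⟩

/-- `A ≅ (ℤ/p)^s` for some prime `p` and some even `s`. -/
def IsEvenElementary (A : Type*) [AddCommGroup A] : Prop :=
  ∃ p s : ℕ, p.Prime ∧ Even s ∧ Nonempty (A ≃+ (Fin s → ZMod p))

/-- `A ≅ (ℤ/p)^s` for some prime `p` and some odd `s`. -/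
def IsOddElementary (A : Type*) [AddCommGroup A] : Prop :=
  ∃ p s : ℕ, p.Prime ∧ Odd s ∧ Nonempty (A ≃+ (Fin s → ZMod p))

lemma IsEvenElementary.not_isOddElementary {A : Type*} [AddCommGroup A]
    (h : IsEvenElementary A) : ¬ IsOddElementary A := by
  rintro ⟨q, t, hq, ht, e'⟩
  obtain ⟨p, s, hp, hs, e⟩ := h
  have h1 := ((nonempty_addEquiv_pi_zmod_iff hp s).mp e).2
  have h2 := ((nonempty_addEquiv_pi_zmod_iff hq t).mp e').2
  have ht0 : t ≠ 0 := by rintro rfl; simp at ht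
  have hpq : q = p := by
    refine (Nat.prime_dvd_prime_iff_eq hq hp).mp (hq.dvd_of_dvd_pow (n := s) ?_)
    rw [← h1, h2]
    exact dvd_pow_self q ht0
  subst hpq
  have hst : s = t := Nat.pow_right_injective hp.two_le (h1.symm.trans h2)
  subst hst
  exact Nat.not_even_iff_odd.mpr ht hs

lemma IsSquareGroup.isEvenElementary {A : Type u} [AddCommGroup A] [AddGroup.FG A]
    (hA : IsSquareGroup A) {p : ℕ} (hp : p.Prime) (h : ∀ x : A, p • x = 0) :
    IsEvenElementary A := by
  have := Fact.mk hp
  obtain ⟨s, hs⟩ := exists_addEquiv_pi_zmod hp h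
  refine ⟨p, s, hp, ?_, hs⟩
  have h1 := ((nonempty_addEquiv_pi_zmod_iff hp s).mp hs).2
  obtain ⟨B, _, ⟨e⟩⟩ := hA
  rw [Nat.card_congr e.toEquiv, Nat.card_prod] at h1
  have hB : Nat.card B ≠ 0 := by
    intro h0
    rw [h0, zero_mul] at h1
    exact pow_ne_zero s hp.ne_zero h1.symm
  have h2 := congrArg (padicValNat p) h1
  rw [padicValNat.mul hB hB, padicValNat.prime_pow] at h2
  exact ⟨_, h2.symm⟩

lemma nsmul_quotient_eq_zero_iff {A : Type*} [AddCommGroup A] {p : ℕ} (H : AddSubgroup A) :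
    (∀ x : A ⧸ H, p • x = 0) ↔ multiplesSubgroup p A ≤ H := by
  constructor
  · rintro h _ ⟨y, rfl⟩
    exact (QuotientAddGroup.eq_zero_iff _).mp (h (QuotientAddGroup.mk' H y))
  · intro h x
    obtain ⟨x, rfl⟩ := QuotientAddGroup.mk'_surjective H x
    rw [← map_nsmul]
    exact (QuotientAddGroup.eq_zero_iff _).mpr (h ⟨x, rfl⟩)

lemma multiplesSubgroup_eq_bot_iff {A : Type*} [AddCommGroup A] {p : ℕ} :
    multiplesSubgroup p A = ⊥ ↔ ∀ x : A, p • x = 0 := by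
  rw [eq_bot_iff]
  exact ⟨fun h x => h ⟨x, rfl⟩, fun h => by rintro _ ⟨y, rfl⟩; exact h y⟩

lemma IsEvenElementary.of_subsingleton {A : Type*} [AddCommGroup A] (h : Subsingleton A) :
    IsEvenElementary A :=
  ⟨2, 0, Nat.prime_two, by simp, (nonempty_addEquiv_pi_zmod_iff Nat.prime_two 0).mpr
    ⟨fun _ => Subsingleton.elim _ _, by simp⟩⟩

lemma exists_addEquiv_pi_zmod_quotient {A : Type*} [AddCommGroup A] {p s : ℕ} (hp : p.Prime)
    (e : Nonempty (A ≃+ (Fin s → ZMod p))) {a : A} (ha : a ≠ 0) : ∃ t, s = t + 1 ∧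
      Nonempty (A ⧸ AddSubgroup.zmultiples a ≃+ (Fin t → ZMod p)) := by
  obtain ⟨h, hcard⟩ := (nonempty_addEquiv_pi_zmod_iff hp s).mp e
  have h1 := index_sup_zmultiples_mul_prime (H := ⊥) hp (by simpa using ha) (by simpa using h a)
  rw [bot_sup_eq, AddSubgroup.index_bot, hcard] at h1
  obtain _ | t := s
  · have h2 : p ∣ 1 := ⟨_, by rw [mul_comm]; simpa using h1.symm⟩
    exact (hp.one_lt.ne' (Nat.dvd_one.mp h2)).elim
  · rw [pow_succ] at h1
    refine ⟨t, rfl, (nonempty_addEquiv_pi_zmod_iff hp t).mpr ⟨?_, ?_⟩⟩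
    · rw [nsmul_quotient_eq_zero_iff, multiplesSubgroup_eq_bot_iff.mpr h]
      exact bot_le
    · exact Nat.eq_of_mul_eq_mul_right hp.pos h1

lemma IsOddElementary.isEvenElementary_quotient {A : Type*} [AddCommGroup A]
    (h : IsOddElementary A) {a : A} (ha : a ≠ 0) :
    IsEvenElementary (A ⧸ AddSubgroup.zmultiples a) := by
  obtain ⟨p, s, hp, hs, e⟩ := h
  obtain ⟨t, rfl, e'⟩ := exists_addEquiv_pi_zmod_quotient hp e ha
  exact ⟨p, t, hp, by simpa [Nat.odd_add_one] using hs, e'⟩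

lemma IsEvenElementary.isOddElementary_quotient {A : Type*} [AddCommGroup A]
    (h : IsEvenElementary A) {a : A} (ha : a ≠ 0) :
    IsOddElementary (A ⧸ AddSubgroup.zmultiples a) := by
  obtain ⟨p, s, hp, hs, e⟩ := h
  obtain ⟨t, rfl, e'⟩ := exists_addEquiv_pi_zmod_quotient hp e ha
  exact ⟨p, t, hp, by simpa [Nat.even_add_one] using hs, e'⟩

/-! ### Reaching an odd elementary abelian group -/

/-- If `A / p A` has even dimension `s`, then `⟨a⟩ ⊇ p A` with `a ∉ p A` has a quotient of odd
dimension `s - 1`. -/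
lemma isOddElementary_quotient_of_notMem {A : Type*} [AddCommGroup A] {p s : ℕ} (hp : p.Prime)
    (hs : Even s) (hcard : (multiplesSubgroup p A).index = p ^ s) {a : A}
    (ha : a ∉ multiplesSubgroup p A)
    (hle : multiplesSubgroup p A ≤ AddSubgroup.zmultiples a) :
    IsOddElementary (A ⧸ AddSubgroup.zmultiples a) := by
  have h1 := index_sup_zmultiples_mul_prime hp ha ⟨a, rfl⟩
  rw [sup_eq_right.mpr hle, hcard] at h1
  obtain _ | s := s
  · have h2 : p ∣ 1 := ⟨_, by rw [mul_comm]; simpa using h1.symm⟩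
    exact (hp.one_lt.ne' (Nat.dvd_one.mp h2)).elim
  · rw [pow_succ] at h1
    refine ⟨p, s, hp, by simpa [Nat.even_add_one] using hs,
      (nonempty_addEquiv_pi_zmod_iff hp s).mpr ⟨(nsmul_quotient_eq_zero_iff _).mpr hle, ?_⟩⟩
    exact Nat.eq_of_mul_eq_mul_right hp.pos h1

lemma isAddCyclic_of_le_zmultiples {A : Type*} [AddCommGroup A] {H : AddSubgroup A} {a : A}
    (hle : H ≤ AddSubgroup.zmultiples a) : IsAddCyclic H :=
  have : IsAddCyclic (AddSubgroup.zmultiples a) :=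
    (AddSubgroup.isAddCyclic_iff_exists_zmultiples_eq_top _).mpr ⟨a, rfl⟩
  isAddCyclic_of_injective (AddSubgroup.inclusion hle) (AddSubgroup.inclusion_injective hle)

/-- The move that repairs parity in misère play: if `p A` is cyclic but neither `0` nor `A`, then
some cyclic subgroup has an elementary abelian quotient of odd dimension. If `A / p A` has odd
dimension it is `p A` itself; otherwise it is generated by an element outside `p A` one of whose
multiples generates `p A`. -/
lemma exists_isOddElementary_quotient {A : Type*} [AddCommGroup A] [AddGroup.FG A] {p : ℕ}
    (hp : p.Prime) (htop : multiplesSubgroup p A ≠ ⊤) (hbot : multiplesSubgroup p A ≠ ⊥) {a : A}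
    (hle : multiplesSubgroup p A ≤ AddSubgroup.zmultiples a) :
    ∃ b : A, b ≠ 0 ∧ IsOddElementary (A ⧸ AddSubgroup.zmultiples b) := by
  obtain ⟨s, hs⟩ := exists_addEquiv_pi_zmod (A := A ⧸ multiplesSubgroup p A) hp
    ((nsmul_quotient_eq_zero_iff _).mpr le_rfl)
  rcases Nat.even_or_odd s with hev | hodd
  · have hcard : (multiplesSubgroup p A).index = p ^ s :=
      ((nonempty_addEquiv_pi_zmod_iff hp s).mp hs).2
    obtain ⟨b, hb, hble⟩ : ∃ b, b ∉ multiplesSubgroup p A ∧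
        multiplesSubgroup p A ≤ AddSubgroup.zmultiples b := by
      by_cases ha : a ∈ multiplesSubgroup p A
      · obtain ⟨c, hc⟩ := id ha
        change p • c = a at hc
        -- any `b` with `p • b = a` has all of `p A = ⟨a⟩` in `⟨b⟩`
        suffices h : ∃ b, b ∉ multiplesSubgroup p A ∧ p • b = a by
          obtain ⟨b, hb, rfl⟩ := h
          exact ⟨b, hb, hle.trans (AddSubgroup.zmultiples_le_of_mem
            ((AddSubgroup.zmultiples b).nsmul_mem (AddSubgroup.mem_zmultiples b) p))⟩
        by_cases hcm : c ∈ multiplesSubgroup p A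
        · -- then `c` can be changed by a `p`-torsion element outside `p A`
          obtain ⟨m, rfl⟩ := AddSubgroup.mem_zmultiples_iff.mp (hle hcm)
          obtain ⟨x, hx⟩ : ∃ x, x ∉ multiplesSubgroup p A := by
            by_contra! h
            exact htop (eq_top_iff.mpr fun x _ => h x)
          obtain ⟨j, hj⟩ := AddSubgroup.mem_zmultiples_iff.mp (hle ⟨x, rfl⟩)
          change j • a = p • x at hj
          have hja : p • (j • m • a) = p • x := by rw [smul_comm, hc, hj]
          refine ⟨x - j • m • a + m • a, fun h => hx ?_, by rw [smul_add, smul_sub, hja, hc]; simp⟩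
          have h2 : x = (x - j • m • a + m • a) - m • a + j • m • a := by abel
          rw [h2]
          exact add_mem (sub_mem h hcm) (AddSubgroup.zsmul_mem _ hcm j)
        · exact ⟨c, hcm, hc⟩
      · exact ⟨a, ha, hle⟩
    exact ⟨b, fun h => hb (h ▸ zero_mem _),
      isOddElementary_quotient_of_notMem hp hev hcard hb hble⟩
  · have hcyc : IsAddCyclic (multiplesSubgroup p A) := isAddCyclic_of_le_zmultiples hle
    obtain ⟨b, hb⟩ := (AddSubgroup.isAddCyclic_iff_exists_zmultiples_eq_top _).mp hcyc
    refine ⟨b, fun h => hbot (by rw [← hb, h, AddSubgroup.zmultiples_zero_eq_bot]), ?_⟩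
    rw [hb]
    exact ⟨p, s, hp, hodd, hs⟩

/-! ### The recursions for the two play rules -/

lemma isSquareGroup_of_subsingleton {A : Type u} [AddCommGroup A] (h : Subsingleton A) :
    IsSquareGroup A :=
  have : Unique A := uniqueOfSubsingleton 0
  ⟨A, inferInstance, ⟨AddEquiv.uniqueProd.symm⟩⟩

lemma isSquareGroup_iff_forall_quotient {A : Type u} [AddCommGroup A] [AddGroup.FG A] :
    IsSquareGroup A ↔ ∀ a : A, a ≠ 0 → ¬ IsSquareGroup (A ⧸ AddSubgroup.zmultiples a) := by
  refine ⟨fun h a ha => h.not_quotient ha, fun h => ?_⟩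
  obtain ⟨a, ha⟩ := exists_isSquareGroup_quotient A
  obtain rfl : a = 0 := by
    by_contra h0
    exact h a h0 ha
  rw [AddSubgroup.zmultiples_zero_eq_bot] at ha
  exact ha.of_addEquiv QuotientAddGroup.quotientBot.symm

/-- A cyclic square is trivial, being a square with a trivial quotient by a cyclic subgroup. -/
lemma IsSquareGroup.subsingleton_of_isAddCyclic {A : Type u} [AddCommGroup A] [IsAddCyclic A]
    (hA : IsSquareGroup A) : Subsingleton A := by
  obtain ⟨a, ha⟩ := IsAddCyclic.exists_generator (α := A)
  have htop : AddSubgroup.zmultiples a = ⊤ := eq_top_iff.mpr fun x _ => ha x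
  have : AddGroup.FG A := AddGroup.fg_of_surjective (f := zmultiplesHom A a) ha
  obtain rfl : a = 0 := by
    by_contra h0
    refine hA.not_quotient h0 (isSquareGroup_of_subsingleton ?_)
    rw [htop]
    exact QuotientAddGroup.subsingleton_quotient_top
  rw [AddSubgroup.zmultiples_zero_eq_bot] at htop
  exact AddSubgroup.subsingleton_iff.mp (subsingleton_of_bot_eq_top htop)

lemma isSquareGroup_multiplesSubgroup {A : Type u} [AddCommGroup A] (hA : IsSquareGroup A)
    (N : ℕ) : IsSquareGroup (multiplesSubgroup N A) := by
  obtain ⟨B, _, ⟨e⟩⟩ := hA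
  have hmap : (multiplesSubgroup N A).map (e : A →+ B × B) =
      (multiplesSubgroup N B).prod (multiplesSubgroup N B) := by
    ext ⟨x, y⟩
    simp only [AddSubgroup.mem_map, AddSubgroup.mem_prod, mem_multiplesSubgroup]
    constructor
    · rintro ⟨_, ⟨z, rfl⟩, h⟩
      rw [map_nsmul] at h
      exact ⟨⟨(e z).1, congrArg Prod.fst h⟩, ⟨(e z).2, congrArg Prod.snd h⟩⟩
    · rintro ⟨⟨x, rfl⟩, ⟨y, rfl⟩⟩
      exact ⟨_, ⟨e.symm (x, y), rfl⟩, by simp⟩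
  exact ⟨multiplesSubgroup N B, inferInstance, ⟨(e.addSubgroupMap _).trans
    ((AddEquiv.addSubgroupCongr hmap).trans (AddSubgroup.prodEquiv _ _))⟩⟩

/-- A square with an elementary abelian quotient by a cyclic subgroup `⟨a⟩` is itself elementary
abelian: `p A ⊆ ⟨a⟩` is a cyclic square. -/
lemma IsSquareGroup.isEvenElementary_of_quotient {A : Type u} [AddCommGroup A] [AddGroup.FG A]
    (hA : IsSquareGroup A) {a : A} (h : IsOddElementary (A ⧸ AddSubgroup.zmultiples a)) :
    IsEvenElementary A := by
  obtain ⟨p, s, hp, -, e⟩ := h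
  have hle := (nsmul_quotient_eq_zero_iff _).mp ((nonempty_addEquiv_pi_zmod_iff hp s).mp e).1
  refine hA.isEvenElementary hp (multiplesSubgroup_eq_bot_iff.mp ?_)
  have : IsAddCyclic (multiplesSubgroup p A) := isAddCyclic_of_le_zmultiples hle
  have := (isSquareGroup_multiplesSubgroup hA p).subsingleton_of_isAddCyclic
  exact AddSubgroup.eq_bot_of_subsingleton _

/-- If the quotient of `A` by a cyclic subgroup is `(ℤ/p)^s` with `s` even, then there is a prime
`q` for which `q A` is cyclic and different from `A`; it may differ from `p` if `s = 0`, as then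
`p` says nothing about `A`. -/
lemma exists_multiplesSubgroup_le_zmultiples {A : Type*} [AddCommGroup A] [AddGroup.FG A]
    [Nontrivial A] {a : A} (h : IsEvenElementary (A ⧸ AddSubgroup.zmultiples a)) :
    ∃ q : ℕ, q.Prime ∧ multiplesSubgroup q A ≠ ⊤ ∧
      multiplesSubgroup q A ≤ AddSubgroup.zmultiples a := by
  by_cases htop : AddSubgroup.zmultiples a = ⊤
  · obtain ⟨x, hx⟩ := exists_ne (0 : A)
    obtain ⟨q, M, hq, -, ⟨y, rfl⟩, hnot⟩ := exists_prime_mem_multiplesSubgroup hx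
    refine ⟨q, hq, fun h => hnot ?_, by rw [htop]; exact le_top⟩
    obtain ⟨z, rfl⟩ : y ∈ multiplesSubgroup q A := h ▸ AddSubgroup.mem_top y
    refine ⟨z, ?_⟩
    change (q * M) • z = M • q • z
    rw [mul_comm, mul_smul]
  · obtain ⟨p, s, hp, -, e⟩ := h
    have hle := (nsmul_quotient_eq_zero_iff _).mp ((nonempty_addEquiv_pi_zmod_iff hp s).mp e).1
    exact ⟨p, hp, fun h => htop (top_le_iff.mp (h ▸ hle)), hle⟩

/-- The recursion for the misère `𝒫`-positions. Only the direction from right to left is delicate: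
if the move from a nonsquare to a square ends in some `(ℤ/p)^s` with `s` even, it has to be
replaced by a move to an elementary abelian group of odd dimension. -/
lemma misere_recursion {A : Type u} [AddCommGroup A] [AddGroup.FG A] [Nontrivial A] :
    ((IsSquareGroup A ∧ ¬ IsEvenElementary A) ∨ IsOddElementary A) ↔
      ∀ a : A, a ≠ 0 → ¬ ((IsSquareGroup (A ⧸ AddSubgroup.zmultiples a) ∧
        ¬ IsEvenElementary (A ⧸ AddSubgroup.zmultiples a)) ∨
          IsOddElementary (A ⧸ AddSubgroup.zmultiples a)) := by
  constructor
  · rintro (⟨hsq, hev⟩ | hodd) a ha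
    · rintro (⟨hsq', -⟩ | hodd')
      · exact hsq.not_quotient ha hsq'
      · exact hev (hsq.isEvenElementary_of_quotient hodd')
    · have hev := hodd.isEvenElementary_quotient ha
      rintro (⟨-, hev'⟩ | hodd')
      · exact hev' hev
      · exact hev.not_isOddElementary hodd'
  · intro h
    by_contra hA
    rw [not_or, not_and, not_not] at hA
    obtain ⟨hsq, hodd⟩ := hA
    by_cases hev : IsEvenElementary A
    · obtain ⟨a, ha⟩ := exists_ne (0 : A)
      exact h a ha (Or.inr (hev.isOddElementary_quotient ha))
    · have hnsq : ¬ IsSquareGroup A := fun hs => hev (hsq hs)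
      rw [isSquareGroup_iff_forall_quotient] at hnsq
      push Not at hnsq
      obtain ⟨a, ha, hsa⟩ := hnsq
      have heva : IsEvenElementary (A ⧸ AddSubgroup.zmultiples a) := by
        by_contra hn
        exact h a ha (Or.inl ⟨hsa, hn⟩)
      obtain ⟨q, hq, htop, hle⟩ := exists_multiplesSubgroup_le_zmultiples heva
      have hbot : multiplesSubgroup q A ≠ ⊥ := by
        intro hb
        obtain ⟨s, e⟩ := exists_addEquiv_pi_zmod hq (multiplesSubgroup_eq_bot_iff.mp hb)
        rcases Nat.even_or_odd s with hs | hs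
        · exact hev ⟨q, s, hq, hs, e⟩
        · exact hodd ⟨q, s, hq, hs, e⟩
      obtain ⟨b, hb, hob⟩ := exists_isOddElementary_quotient hq htop hbot hle
      exact h b hb (Or.inr hob)

/-! ### Noetherian induction on the game -/

/-- Criterion for a property `S` of groups to describe the `𝒫`-positions: it has to be right on
trivial groups and to satisfy the defining recursion on nontrivial ones. -/
lemma isPPosition_iff_of_recursion (r : PlayRule) (S : ∀ (A : Type u) [AddCommGroup A], Prop)
    (h0 : ∀ (A : Type u) [AddCommGroup A], Subsingleton A → (S A ↔ r = PlayRule.normal))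
    (h1 : ∀ (A : Type u) [AddCommGroup A] [AddGroup.FG A], Nontrivial A →
      (S A ↔ ∀ a : A, a ≠ 0 → ¬ S (A ⧸ AddSubgroup.zmultiples a)))
    (A : Type u) [AddCommGroup A] [AddGroup.FG A] :
    abelianGroupGame.{u}.IsPPosition r (AddCommGrpCat.of A) ↔ S A := by
  have : Module.Finite ℤ A := Module.Finite.iff_addGroup_fg.mpr inferInstance
  -- every position reached from `A` is a quotient of `A`, by ever larger subgroups
  suffices key : ∀ (H : Submodule ℤ A) (B : Type u) [AddCommGroup B] (f : A →ₗ[ℤ] B),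
      Function.Surjective f → LinearMap.ker f = H →
        (abelianGroupGame.{u}.IsPPosition r (AddCommGrpCat.of B) ↔ S B) ∧
        (abelianGroupGame.{u}.IsNPosition r (AddCommGrpCat.of B) ↔ ¬ S B) from
    (key ⊥ A LinearMap.id Function.surjective_id LinearMap.ker_id).1
  intro H
  induction H using WellFoundedGT.induction with
  | ind H ih =>
    intro B _ f hf hH
    have hfin : Module.Finite ℤ B := Module.Finite.of_surjective f hf
    have hfg : AddGroup.FG B := Module.Finite.iff_addGroup_fg.mp hfin
    have step : ∀ b : B, b ≠ 0 →
        (abelianGroupGame.{u}.IsPPosition r (AddCommGrpCat.of (B ⧸ AddSubgroup.zmultiples b)) ↔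
          S (B ⧸ AddSubgroup.zmultiples b)) ∧
        (abelianGroupGame.{u}.IsNPosition r (AddCommGrpCat.of (B ⧸ AddSubgroup.zmultiples b)) ↔
          ¬ S (B ⧸ AddSubgroup.zmultiples b)) := by
      intro b hb
      let π : B →ₗ[ℤ] B ⧸ AddSubgroup.zmultiples b :=
        (QuotientAddGroup.mk' (AddSubgroup.zmultiples b)).toIntLinearMap
      refine ih (LinearMap.ker (π.comp f)) ?_ _ (π.comp f)
        ((QuotientAddGroup.mk'_surjective _).comp hf) rfl
      obtain ⟨a, rfl⟩ := hf b
      rw [← hH]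
      refine lt_of_le_of_ne (LinearMap.ker_le_ker_comp f π) fun h => hb ?_
      have ha : a ∈ LinearMap.ker (π.comp f) :=
        (QuotientAddGroup.eq_zero_iff (f a)).mpr (AddSubgroup.mem_zmultiples _)
      rw [← h] at ha
      exact ha
    have hterm : abelianGroupGame.{u}.IsTerminal (AddCommGrpCat.of B) ↔ Subsingleton B := by
      change IsEmpty {b : B // b ≠ 0} ↔ _
      rw [isEmpty_subtype]
      simp only [not_not]
      exact (subsingleton_iff_forall_eq 0).symm
    have hmis : r = PlayRule.misere ↔ ¬ r = PlayRule.normal := by cases r <;> simp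
    rcases subsingleton_or_nontrivial B with hB | hB
    · have hmove : ∀ m : abelianGroupGame.{u}.Move (AddCommGrpCat.of B), False := fun m =>
        m.2 (Subsingleton.elim _ _)
      rw [h0 B hB, ← hmis]
      refine ⟨⟨fun h => ?_, fun h => .over h (hterm.mpr hB)⟩,
        ⟨fun h => ?_, fun h => .over h (hterm.mpr hB)⟩⟩
      · rcases h with ⟨hr, _⟩ | ⟨hp, _⟩
        · exact hr
        · exact (hp (hterm.mpr hB)).elim
      · rcases h with ⟨hr, _⟩ | ⟨m, _⟩
        · exact hr
        · exact (hmove m).elim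
    · have hnt : ¬ abelianGroupGame.{u}.IsTerminal (AddCommGrpCat.of B) := fun h =>
        not_subsingleton B (hterm.mp h)
      rw [h1 B hB]
      refine ⟨⟨fun h b hb => ?_, fun h => .reply hnt fun m => ?_⟩, ⟨fun h hall => ?_, fun h => ?_⟩⟩
      · rcases h with ⟨_, hp⟩ | ⟨_, h⟩
        · exact (hnt hp).elim
        · exact (step b hb).2.mp (h ⟨b, hb⟩)
      · exact (step m.1 m.2).2.mpr (h m.1 m.2)
      · rcases h with ⟨_, hp⟩ | ⟨m, h⟩
        · exact hnt hp
        · exact hall m.1 m.2 ((step m.1 m.2).1.mp h)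
      · push Not at h
        obtain ⟨b, hb, hS⟩ := h
        exact .move ⟨b, hb⟩ ((step b hb).1.mpr hS)

theorem theorem1p1 (A : Type u) [AddCommGroup A] [AddGroup.FG A] :
    (abelianGroupGame.{u}.IsPPosition PlayRule.normal (AddCommGrpCat.of A) ↔
      IsSquareGroup A) ∧
    (abelianGroupGame.{u}.IsPPosition PlayRule.misere (AddCommGrpCat.of A) ↔
      (IsSquareGroup A ∧
          ¬ ∃ p s : ℕ, p.Prime ∧ Even s ∧ Nonempty (A ≃+ (Fin s → ZMod p))) ∨
        ∃ p s : ℕ, p.Prime ∧ Odd s ∧ Nonempty (A ≃+ (Fin s → ZMod p))) := by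
  constructor
  · exact isPPosition_iff_of_recursion PlayRule.normal (fun A _ => IsSquareGroup A)
      (fun A _ hA => iff_of_true (isSquareGroup_of_subsingleton hA) rfl)
      (fun A _ _ _ => isSquareGroup_iff_forall_quotient) A
  · refine isPPosition_iff_of_recursion PlayRule.misere
      (fun A _ => (IsSquareGroup A ∧ ¬ IsEvenElementary A) ∨ IsOddElementary A)
      (fun A _ hA => iff_of_false ?_ (by simp)) (fun A _ _ _ => misere_recursion) A
    have hev := IsEvenElementary.of_subsingleton hA
    rintro (⟨-, h⟩ | h)
    · exact h hev
    · exact hev.not_isOddElementary h
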